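/- Let $X,Y$ be complex manifolds and let $f:X\to Y$ be an abelian fibration, that is, a proper holomorphic map whose general fibre (the fibre over every point of some dense open subset of $Y$) is a compact complex torus; neither a section nor a relatively ample line bundle is required. Let $X_i\subset X$ be the set of points at which the differential $Df$ has rank exactly $\dim Y-i$; thus $X_0$ is the smooth locus of $f$. Let $\mathrm{Discr}\subset Y$ be the set of critical values of $f$, and let $\mathrm{Discr}_1=f(\overline{X_2})$, where $\overline{X_2}$ is the closure of $X_2$. Let $C\subset Y\setminus \mathrm{Discr}_1$ be a smooth curve (a one-dimensional complex submanifold) which meets $\mathrm{Discr}$ transversally: at every $y\in C\cap\mathrm{Discr}$ the tangent line $T_yC$ is not contained in the tangent cone of $\mathrm{Discr}$ at $y$ (at a point where $\mathrm{Discr}$ is a smooth hypersurface this says $T_yC+T_y\mathrm{Discr}=T_yY$). Then $C$ is Néron regular: the smooth locus of the map $f:f^{-1}(C)\to C$, where $f^{-1}(C)=X\times_YC$ is the analytic fibre product, equals $X_0\cap f^{-1}(C)$. Here a point $x\in f^{-1}(C)$ belongs to the smooth locus of $f^{-1}(C)\to C$ if $f^{-1}(C)$ is smooth at $x$, i.e.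 it is near $x$ a complex submanifold of $X$ with tangent space $(Df_x)^{-1}(T_{f(x)}C)$, and $Df_x$ maps this tangent space onto $T_{f(x)}C$. -/

import Mathlib

open Set
open scoped Manifold ContDiff

noncomputable section

/-- `S` is, near its point `x`, an (embedded, locally closed) complex submanifold of the complex
manifold `M`, and `T` is its tangent space at `x`: in some holomorphic chart `φ` around `x` the
set `S` becomes an affine linear subspace through `φ x`, with direction `W`, and
`T = (dφ_x)⁻¹(W)`. -/
def IsSubmanifoldAt {E M : Type*} [NormedAddCommGroup E] [NormedSpace ℂ E]
    [TopologicalSpace M] [ChartedSpace E M]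
    (S : Set M) (x : M) (T : Submodule ℂ (TangentSpace 𝓘(ℂ, E) x)) : Prop :=
  x ∈ S ∧ ∃ φ ∈ IsManifold.maximalAtlas 𝓘(ℂ, E) ω M, x ∈ φ.source ∧ ∃ W : Submodule ℂ E,
    (∀ z ∈ φ.source, z ∈ S ↔ φ z - φ x ∈ W) ∧
    T = W.comap (mfderiv 𝓘(ℂ, E) 𝓘(ℂ, E) φ x).toLinearMap

/-- A smooth (complex) curve in a complex manifold `M`: a one-dimensional complex submanifold. -/
def IsSmoothCurve {E M : Type*} [NormedAddCommGroup E] [NormedSpace ℂ E]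
    [TopologicalSpace M] [ChartedSpace E M] (C : Set M) : Prop :=
  ∀ y ∈ C, ∃ T : Submodule ℂ (TangentSpace 𝓘(ℂ, E) y),
    IsSubmanifoldAt C y T ∧ Module.finrank ℂ T = 1

/-- The tangent cone at `y` of a subset `D` of a complex manifold, i.e. the set of all limits of
`c k • (y k - y)` with `y k ∈ D`, `y k → y` and `c k` complex numbers, computed in the preferred
chart at `y` (with respect to which Mathlib identifies `TangentSpace 𝓘(ℂ, E) y` with `E`).
At a point where `D` is a submanifold it is the tangent space of `D`. -/
def tangentConeOf {E M : Type*} [NormedAddCommGroup E] [NormedSpace ℂ E]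
    [TopologicalSpace M] [ChartedSpace E M] (D : Set M) (y : M) :
    Set (TangentSpace 𝓘(ℂ, E) y) :=
  tangentConeAt ℂ (chartAt E y '' (D ∩ (chartAt E y).source)) (chartAt E y y)

/-- The smooth curve `C` meets `D` transversally: at each common point `y` the tangent line of `C`
is not contained in the tangent cone of `D`. At a point where `D` is a smooth hypersurface this
says `T_y C + T_y D = T_y M`, see `not_subset_iff_sup_eq_top`. No smoothness of `D` is assumed. -/
def MeetsTransversally {E M : Type*} [NormedAddCommGroup E] [NormedSpace ℂ E]
    [TopologicalSpace M] [ChartedSpace E M] (C D : Set M) : Prop :=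
  ∀ y ∈ C ∩ D, ∀ T : Submodule ℂ (TangentSpace 𝓘(ℂ, E) y), IsSubmanifoldAt C y T →
    ¬ ((T : Set (TangentSpace 𝓘(ℂ, E) y)) ⊆ tangentConeOf D y)

/-- If the tangent cone is a hyperplane `H`, the condition in `MeetsTransversally` is the usual
transversality condition. -/
theorem not_subset_iff_sup_eq_top {V : Type*} [AddCommGroup V] [Module ℂ V]
    (L H : Submodule ℂ V) (hH : IsCoatom H) :
    ¬ ((L : Set V) ⊆ H) ↔ L ⊔ H = ⊤ := by
  rw [SetLike.coe_subset_coe]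
  constructor
  · intro h
    exact hH.2 _ (lt_of_le_of_ne le_sup_right fun e => h (by rw [e]; exact le_sup_left))
  · intro h hle
    exact hH.1 (by rwa [sup_eq_right.2 hle] at h)

/-- The fibre `f⁻¹(y)` is a compact complex torus: there are a lattice `Λ ⊆ ℂⁿ` and a holomorphic
immersion `ℂⁿ → X` with image `f⁻¹(y)`, two points having the same image exactly when they differ
by an element of `Λ`; that is, `ℂⁿ/Λ` is mapped isomorphically onto the submanifold `f⁻¹(y)`. -/
def HasTorusFibre {E X Y : Type*} [NormedAddCommGroup E] [NormedSpace ℂ E]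
    [TopologicalSpace X] [ChartedSpace E X] (f : X → Y) (y : Y) : Prop :=
  ∃ (n : ℕ) (Λ : Submodule ℤ (Fin n → ℂ)) (ψ : (Fin n → ℂ) → X),
    DiscreteTopology Λ ∧ Submodule.span ℝ (Λ : Set (Fin n → ℂ)) = ⊤ ∧
    ContMDiff 𝓘(ℂ, Fin n → ℂ) 𝓘(ℂ, E) ω ψ ∧
    (∀ a, Function.Injective (mfderiv 𝓘(ℂ, Fin n → ℂ) 𝓘(ℂ, E) ψ a)) ∧
    range ψ = f ⁻¹' {y} ∧
    ∀ a b, ψ a = ψ b ↔ a - b ∈ Λ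

/-- `f : X → Y` is an abelian fibration: a proper holomorphic map of complex manifolds whose
general fibre is a compact complex torus. Neither a section nor a relatively ample line bundle is
required. -/
structure IsAbelianFibration {EX EY X Y : Type*}
    [NormedAddCommGroup EX] [NormedSpace ℂ EX] [NormedAddCommGroup EY] [NormedSpace ℂ EY]
    [TopologicalSpace X] [ChartedSpace EX X] [TopologicalSpace Y] [ChartedSpace EY Y]
    (f : X → Y) : Prop where
  holomorphic : ContMDiff 𝓘(ℂ, EX) 𝓘(ℂ, EY) ω f
  proper : IsProperMap f
  general_fibre : ∃ U : Set Y, IsOpen U ∧ Dense U ∧ ∀ y ∈ U, HasTorusFibre (E := EX) f y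

section Strata

variable {EX EY X Y : Type*}
  [NormedAddCommGroup EX] [NormedSpace ℂ EX] [NormedAddCommGroup EY] [NormedSpace ℂ EY]
  [TopologicalSpace X] [ChartedSpace EX X] [TopologicalSpace Y] [ChartedSpace EY Y]

variable (EX EY) in
/-- `X_i`: the set of points at which the differential of `f` has rank exactly `dim Y - i`. -/
def rankStratum (f : X → Y) (i : ℕ) : Set X :=
  {x | Module.finrank ℂ (mfderiv 𝓘(ℂ, EX) 𝓘(ℂ, EY) f x).toLinearMap.range + i
    = Module.finrank ℂ EY}

variable (EX EY) in
/-- `X_0`, the smooth locus of `f`: the points at which the differential has maximal rank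
`dim Y`. -/
def smoothLocus (f : X → Y) : Set X := rankStratum EX EY f 0

variable (EX EY) in
/-- The discriminant of `f`: the set of its critical values. -/
def discr (f : X → Y) : Set Y :=
  f '' {x | ¬ Function.Surjective (mfderiv 𝓘(ℂ, EX) 𝓘(ℂ, EY) f x)}

variable (EX EY) in
/-- `Discr_i = f(closure of X_{i+1})`. -/
def discrStratum (f : X → Y) (i : ℕ) : Set Y := f '' closure (rankStratum EX EY f (i + 1))

variable (EX EY) in
/-- The smooth locus of the map `f⁻¹(C) → C`, for a smooth curve `C`, where `f⁻¹(C)` is the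
analytic space `X ×_Y C`. Its Zariski tangent space at `x` is `(df_x)⁻¹(T_{f(x)} C)`; it is smooth
at `x` exactly when its underlying set is a submanifold near `x` with that tangent space, and then
the map to `C` is smooth at `x` when its differential maps this space onto `T_{f(x)} C`. -/
def smoothLocusOver (f : X → Y) (C : Set Y) : Set X :=
  {x | ∃ (TC : Submodule ℂ (TangentSpace 𝓘(ℂ, EY) (f x)))
      (TF : Submodule ℂ (TangentSpace 𝓘(ℂ, EX) x)),
    IsSubmanifoldAt C (f x) TC ∧ IsSubmanifoldAt (f ⁻¹' C) x TF ∧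
    TF = TC.comap (mfderiv 𝓘(ℂ, EX) 𝓘(ℂ, EY) f x).toLinearMap ∧
    TF.map (mfderiv 𝓘(ℂ, EX) 𝓘(ℂ, EY) f x).toLinearMap = TC}

variable (EX EY) in
/-- The curve `C` is Néron regular: the smooth locus of `f⁻¹(C) → C` is `X_0 ∩ f⁻¹(C)`. -/
def IsNeronRegular (f : X → Y) (C : Set Y) : Prop :=
  smoothLocusOver EX EY f C = smoothLocus EX EY f ∩ f ⁻¹' C

end Strata

end

/-! One inclusion is the submersion theorem: where `Df` is onto, a chart can be chosen in which `f`
is linear, so `f⁻¹(C)` is the linear preimage of `C` (`IsSubmanifoldAt.preimage`). For the other,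
suppose `f⁻¹(C) → C` is smooth at `x` but `Df_x` is not onto. Smoothness gives `T_yC ≤ range Df_x`,
where `y = f x`, so `f⁻¹(C)` has codimension `rank Df_x - dim C < dim Y - dim C`. At a nearby point
of `f⁻¹(C)` where `Df` were onto, `Df` would induce a surjection of normal spaces, forcing
codimension at least `dim Y - dim C`. Hence `f⁻¹(C)` is critical near `x` and maps into `Discr`.
Since its tangent space maps onto `T_yC`, this line lies in the tangent cone of `Discr`, against
transversality. -/

open Filter Topology

/-! ### Linear algebra: the codimension count. -/

section Linear

variable {E F : Type*} [NormedAddCommGroup E] [NormedSpace ℂ E] [FiniteDimensional ℂ E]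
  [NormedAddCommGroup F] [NormedSpace ℂ F] [FiniteDimensional ℂ F]

/-- A linear map `A` is surjective as soon as some surjective linear map sends `A⁻¹(V)` into a
subspace `V` of the range of `A`. -/
theorem LinearMap.surjective_of_comap_le_comap (A B : E →ₗ[ℂ] F) (V : Submodule ℂ F)
    (hV : V ≤ A.range) (hBV : V.comap A ≤ V.comap B) (hB : Function.Surjective B) :
    Function.Surjective A := by
  have hle : (V.comap A).map A = V := by
    rw [Submodule.map_comap_eq, inf_eq_right.2 hV]
  have h1 := Submodule.finrank_quotient_add_finrank (V.comap A)
  have h2 := Submodule.finrank_quotient_add_finrank V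
  have h3 := A.finrank_range_add_finrank_ker
  have h4 := (A.domRestrict (V.comap A)).finrank_range_add_finrank_ker
  rw [LinearMap.range_domRestrict, hle] at h4
  have h5 : Module.finrank ℂ (A.domRestrict (V.comap A)).ker = Module.finrank ℂ A.ker := by
    have hker : A.ker ≤ V.comap A := LinearMap.ker_le_comap A
    rw [LinearMap.ker_domRestrict]
    exact (Submodule.comapSubtypeEquivOfLe hker).finrank_eq
  -- `B` descends to a surjection of quotients, while `V ≤ A.range` makes the dimension of the
  -- source equal to `rank A - dim V`.
  have h6 : Module.finrank ℂ (F ⧸ V) ≤ Module.finrank ℂ (E ⧸ V.comap A) := by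
    refine LinearMap.finrank_le_finrank_of_surjective
      (f := Submodule.mapQ (V.comap A) V B hBV) ?_
    intro y
    obtain ⟨y, rfl⟩ := Submodule.mkQ_surjective V y
    obtain ⟨x, rfl⟩ := hB y
    exact ⟨Submodule.Quotient.mk x, rfl⟩
  refine LinearMap.range_eq_top.1 (Submodule.eq_top_of_finrank_eq ?_)
  have h7 := Submodule.finrank_le A.range
  omega

end Linear

/-! ### Derivatives along affine slices, tangent cones and the inverse function theorem. -/

section Calculus

variable {E F : Type*} [NormedAddCommGroup E] [NormedSpace ℂ E]
  [NormedAddCommGroup F] [NormedSpace ℂ F]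

theorem HasFDerivAt.tendsto_line {G : E → F} {G' : E →L[ℂ] F} {z : E} (hG : HasFDerivAt G G' z)
    (w : E) :
    Tendsto (fun t : ℂ => t⁻¹ • (G (z + t • w) - G z)) (𝓝[≠] 0) (𝓝 (G' w)) := by
  have h := (hG.hasLineDerivAt w).tendsto_slope_zero
  simpa using h

theorem tendsto_add_smul_nhds (z w : E) : Tendsto (fun t : ℂ => z + t • w) (𝓝 0) (𝓝 z) := by
  have h : Continuous fun t : ℂ => z + t • w := by fun_prop
  simpa using h.tendsto 0

/-- The derivative of a map sending an affine subspace into another one respects the directions. -/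
theorem HasFDerivAt.mem_of_eventually_sub_mem [FiniteDimensional ℂ F] {G : E → F} {G' : E →L[ℂ] F}
    {z p : E} {q : F} (hG : HasFDerivAt G G' z) {W : Submodule ℂ E} {V : Submodule ℂ F}
    (hz : z - p ∈ W) (h : ∀ᶠ u in 𝓝 z, u - p ∈ W → G u - q ∈ V) {w : E} (hw : w ∈ W) :
    G' w ∈ V := by
  refine V.closed_of_finiteDimensional.mem_of_tendsto (hG.tendsto_line w) ?_
  filter_upwards [((tendsto_add_smul_nhds z w).eventually h).filter_mono nhdsWithin_le_nhds]
    with t ht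
  refine V.smul_mem _ ?_
  have h1 := ht (by rw [add_sub_right_comm]; exact W.add_mem hz (W.smul_mem _ hw))
  simpa using V.sub_mem h1 (h.self_of_nhds hz)

theorem HasFDerivAt.mem_tangentConeAt {G : E → F} {G' : E →L[ℂ] F} {z : E}
    (hG : HasFDerivAt G G' z) {D : Set F} {w : E} (h : ∀ᶠ t : ℂ in 𝓝 0, G (z + t • w) ∈ D) :
    G' w ∈ tangentConeAt ℂ D (G z) := by
  refine mem_tangentConeAt_of_seq (𝓝[≠] (0 : ℂ)) (fun t => t⁻¹) (fun t => G (z + t • w) - G z)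
    ?_ ?_ (hG.tendsto_line w)
  · have h1 := (hG.continuousAt.tendsto.comp (tendsto_add_smul_nhds z w)).sub_const (G z)
    rw [sub_self] at h1
    exact h1.mono_left nhdsWithin_le_nhds
  · filter_upwards [h.filter_mono nhdsWithin_le_nhds] with t ht
    simpa using ht

/-- A holomorphic map tangent to the identity at `p` is a local biholomorphism there. -/
theorem ContDiffAt.exists_openPartialHomeomorph [FiniteDimensional ℂ E] {Θ : E → E}
    {p : E}
    (hΘ : ContDiffAt ℂ ω Θ p) (hΘ' : HasFDerivAt Θ (ContinuousLinearMap.id ℂ E) p) {U : Set E}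
    (hU : U ∈ 𝓝 p) :
    ∃ e : OpenPartialHomeomorph E E, ⇑e = Θ ∧ p ∈ e.source ∧ e.source ⊆ U ∧
      ContDiffOn ℂ ω e e.source ∧ ContDiffOn ℂ ω e.symm e.target := by
  have : CompleteSpace E := FiniteDimensional.complete ℂ E
  have hΘ2 : HasFDerivAt Θ ((ContinuousLinearEquiv.refl ℂ E : E ≃L[ℂ] E) : E →L[ℂ] E) p := hΘ'
  let e := hΘ.toOpenPartialHomeomorph Θ hΘ2 (by simp)
  have hp : p ∈ e.source := hΘ.mem_toOpenPartialHomeomorph_source hΘ2 (by simp)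
  have hsymm : ContDiffAt ℂ ω e.symm (Θ p) := hΘ.to_localInverse hΘ2 (by simp)
  have hN : ∀ᶠ z in 𝓝 p, z ∈ U ∧ ContDiffAt ℂ ω Θ z ∧ ContDiffAt ℂ ω e.symm (Θ z) :=
    Eventually.and hU ((hΘ.eventually (by simp)).and
      (hΘ.continuousAt.eventually (hsymm.eventually (by simp))))
  obtain ⟨N, hNU, hNo, hpN⟩ := mem_nhds_iff.1 hN
  -- Analyticity at a point is an open condition, so shrinking the source makes both `e` and its
  -- inverse analytic throughout.
  refine ⟨e.restrOpen N hNo, rfl, ⟨hp, hpN⟩, fun z hz => (hNU hz.2).1,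
    fun z hz => (hNU hz.2).2.1.contDiffWithinAt, fun y hy => ?_⟩
  have hz := (e.restrOpen N hNo).map_target hy
  have h := (hNU hz.2).2.2
  have hy' : Θ ((e.restrOpen N hNo).symm y) = y := (e.restrOpen N hNo).right_inv hy
  rw [hy'] at h
  exact h.contDiffWithinAt

end Calculus

/-! ### Passage to charts and the two inclusions. -/

section Manifold

variable {EX EY X Y : Type*}
  [NormedAddCommGroup EX] [NormedSpace ℂ EX] [NormedAddCommGroup EY] [NormedSpace ℂ EY]
  [TopologicalSpace X] [ChartedSpace EX X]
  [TopologicalSpace Y] [ChartedSpace EY Y]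

theorem OpenPartialHomeomorph.mdifferentiable_of_mem_maximalAtlas
    {φ : OpenPartialHomeomorph X EX} (hφ : φ ∈ IsManifold.maximalAtlas 𝓘(ℂ, EX) ω X) :
    φ.MDifferentiable 𝓘(ℂ, EX) 𝓘(ℂ, EX) :=
  ⟨(contMDiffOn_of_mem_maximalAtlas hφ).mdifferentiableOn (by simp),
    (contMDiffOn_symm_of_mem_maximalAtlas hφ).mdifferentiableOn (by simp)⟩

theorem contDiffAt_in_charts {f : X → Y} (hf : ContMDiff 𝓘(ℂ, EX) 𝓘(ℂ, EY) ω f)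
    {φ : OpenPartialHomeomorph X EX} (hφ : φ ∈ IsManifold.maximalAtlas 𝓘(ℂ, EX) ω X)
    {ψ : OpenPartialHomeomorph Y EY} (hψ : ψ ∈ IsManifold.maximalAtlas 𝓘(ℂ, EY) ω Y)
    {x : X} (hx : x ∈ φ.source) (hfx : f x ∈ ψ.source) :
    ContDiffAt ℂ ω (fun z => ψ (f (φ.symm z))) (φ x) := by
  have e : φ.symm (φ x) = x := φ.left_inv hx
  have h1 := contMDiffAt_symm_of_mem_maximalAtlas hφ (φ.map_source hx)
  have h2 : ContMDiffAt 𝓘(ℂ, EY) 𝓘(ℂ, EY) ω ψ (f (φ.symm (φ x))) :=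
    contMDiffAt_of_mem_maximalAtlas hψ (by rwa [e])
  exact (h2.comp (φ x) ((hf (φ.symm (φ x))).comp (φ x) h1)).contDiffAt

/-- The derivative of a holomorphic map read in charts. -/
theorem hasFDerivAt_in_charts {f : X → Y} (hf : ContMDiff 𝓘(ℂ, EX) 𝓘(ℂ, EY) ω f)
    {φ : OpenPartialHomeomorph X EX} (hφ : φ ∈ IsManifold.maximalAtlas 𝓘(ℂ, EX) ω X)
    {ψ : OpenPartialHomeomorph Y EY} (hψ : ψ ∈ IsManifold.maximalAtlas 𝓘(ℂ, EY) ω Y)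
    {x : X} (hx : x ∈ φ.source) (hfx : f x ∈ ψ.source) :
    ∃ G' : EX →L[ℂ] EY, HasFDerivAt (fun z => ψ (f (φ.symm z))) G' (φ x) ∧
      ∀ v : TangentSpace 𝓘(ℂ, EX) x, G' (mfderiv 𝓘(ℂ, EX) 𝓘(ℂ, EX) φ x v) =
        mfderiv 𝓘(ℂ, EY) 𝓘(ℂ, EY) ψ (f x) (mfderiv 𝓘(ℂ, EX) 𝓘(ℂ, EY) f x v) := by
  have dφ := OpenPartialHomeomorph.mdifferentiable_of_mem_maximalAtlas hφ
  have dψ := OpenPartialHomeomorph.mdifferentiable_of_mem_maximalAtlas hψ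
  have hG := ((contDiffAt_in_charts hf hφ hψ hx hfx).differentiableAt (by simp)).hasFDerivAt
  refine ⟨_, hG, fun v => ?_⟩
  have h1 := hG.hasMFDerivAt.comp x (dφ.mdifferentiableAt hx).hasMFDerivAt
  have h2 := (dψ.mdifferentiableAt hfx).hasMFDerivAt.comp x
    (hf.mdifferentiable (by simp) x).hasMFDerivAt
  have h3 : (ψ ∘ f) =ᶠ[𝓝 x] (fun z => ψ (f (φ.symm z))) ∘ φ := by
    filter_upwards [φ.open_source.mem_nhds hx] with u hu
    simp [φ.left_inv hu]
  exact DFunLike.congr_fun (hasMFDerivAt_unique h1 (h2.congr_of_eventuallyEq h3.symm)) v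

variable [FiniteDimensional ℂ EY]

theorem mem_smoothLocus_iff {f : X → Y} {x : X} :
    x ∈ smoothLocus EX EY f ↔ Function.Surjective (mfderiv 𝓘(ℂ, EX) 𝓘(ℂ, EY) f x) := by
  have : FiniteDimensional ℂ (TangentSpace 𝓘(ℂ, EY) (f x)) :=
    inferInstanceAs (FiniteDimensional ℂ EY)
  refine Iff.trans ?_ LinearMap.range_eq_top
  constructor
  · intro h
    exact Submodule.eq_top_of_finrank_eq h
  · intro h
    change Module.finrank ℂ (mfderiv 𝓘(ℂ, EX) 𝓘(ℂ, EY) f x).toLinearMap.range + 0 = _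
    rw [h]
    exact finrank_top ℂ (TangentSpace 𝓘(ℂ, EY) (f x))

variable [FiniteDimensional ℂ EX]

/-- At a point of the smooth locus over `C`, where `C` meets the discriminant transversally, the
map is a submersion: otherwise all nearby points of `f⁻¹(C)` would be critical. -/
theorem surjective_mfderiv_of_mem_smoothLocusOver [IsManifold 𝓘(ℂ, EY) ω Y] {f : X → Y}
    (hf : ContMDiff 𝓘(ℂ, EX) 𝓘(ℂ, EY) ω f) {C : Set Y}
    (htrans : MeetsTransversally (E := EY) C (discr EX EY f)) {x : X}
    (hx : x ∈ smoothLocusOver EX EY f C) :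
    Function.Surjective (mfderiv 𝓘(ℂ, EX) 𝓘(ℂ, EY) f x) := by
  obtain ⟨TC, TF, hTC, ⟨-, φ, hφ, hxφ, W, hW, hTF⟩, h1, h2⟩ := hx
  have hTC0 := hTC
  obtain ⟨hyC, ψ, hψ, hyψ, V, hV, hTCV⟩ := hTC0
  by_contra hns
  refine htrans (f x) ⟨hyC, x, hns, rfl⟩ TC hTC ?_
  intro τ hτ
  rw [SetLike.mem_coe, ← h2] at hτ
  obtain ⟨v, hv, rfl⟩ := hτ
  have dφ := OpenPartialHomeomorph.mdifferentiable_of_mem_maximalAtlas hφ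
  have dψ := OpenPartialHomeomorph.mdifferentiable_of_mem_maximalAtlas hψ
  obtain ⟨A, -, hA⟩ := hasFDerivAt_in_charts hf hφ hψ hxφ hyψ
  have memTF : ∀ u, u ∈ TF ↔ mfderiv 𝓘(ℂ, EX) 𝓘(ℂ, EX) φ x u ∈ W := fun u => by
    rw [hTF]; exact Iff.rfl
  have memTC : ∀ u, u ∈ TC ↔ mfderiv 𝓘(ℂ, EY) 𝓘(ℂ, EY) ψ (f x) u ∈ V := fun u => by
    rw [hTCV]; exact Iff.rfl
  have memTF' : ∀ u, u ∈ TF ↔ mfderiv 𝓘(ℂ, EX) 𝓘(ℂ, EY) f x u ∈ TC := fun u => by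
    rw [h1]; exact Iff.rfl
  have hWA : ∀ w, A w ∈ V → w ∈ W := by
    intro w hw
    obtain ⟨u, rfl⟩ := dφ.mfderiv_surjective hxφ w
    rw [hA] at hw
    exact (memTF u).1 ((memTF' u).2 ((memTC _).2 hw))
  have hVA : V ≤ A.toLinearMap.range := by
    intro u hu
    obtain ⟨τ, rfl⟩ := dψ.mfderiv_surjective hyψ u
    have hu' := (memTC τ).2 hu
    rw [← h2] at hu'
    obtain ⟨v, -, rfl⟩ := hu'
    exact ⟨_, hA v⟩
  have hAns : ¬ Function.Surjective A := by
    intro hs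
    refine hns fun u => ?_
    obtain ⟨w, hw⟩ := hs (mfderiv 𝓘(ℂ, EY) 𝓘(ℂ, EY) ψ (f x) u)
    obtain ⟨v, rfl⟩ := dφ.mfderiv_surjective hxφ w
    rw [hA] at hw
    exact ⟨v, dψ.mfderiv_injective hyψ hw⟩
  have hnhds : ∀ {χ : OpenPartialHomeomorph Y EY} {x'}, x' ∈ φ.source → f x' ∈ χ.source →
      ∀ᶠ u in 𝓝 (φ x'), u ∈ φ.target ∧ f (φ.symm u) ∈ χ.source := by
    intro χ x' hx' hfx'
    refine Eventually.and (φ.open_target.mem_nhds (φ.map_source hx')) ?_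
    have hc : ContinuousAt (fun u => f (φ.symm u)) (φ x') :=
      hf.continuous.continuousAt.comp (φ.continuousAt_symm (φ.map_source hx'))
    refine hc.tendsto.eventually (χ.open_source.mem_nhds ?_)
    rwa [φ.left_inv hx']
  -- The derivative `B` at `z` sends `W` into `V`, and `W` contains `A⁻¹(V)`; so surjectivity at `z`
  -- would propagate back to `A`.
  have hcrit : ∀ z ∈ φ.target, f (φ.symm z) ∈ ψ.source → z - φ x ∈ W →
      ¬ Function.Surjective (mfderiv 𝓘(ℂ, EX) 𝓘(ℂ, EY) f (φ.symm z)) := by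
    intro z hz hfz hzW hs
    have hxz := φ.map_target hz
    obtain ⟨B, hB, hB'⟩ := hasFDerivAt_in_charts hf hφ hψ hxz hfz
    refine hAns (LinearMap.surjective_of_comap_le_comap A.toLinearMap B.toLinearMap V hVA
      (fun w hw => ?_) fun u => ?_)
    · refine hB.mem_of_eventually_sub_mem (p := φ x) (q := ψ (f x)) (W := W) (V := V) ?_ ?_
        (hWA w hw)
      · rwa [φ.right_inv hz]
      · filter_upwards [hnhds hxz hfz] with u hu huW
        refine (hV _ hu.2).1 ((hW _ (φ.map_target hu.1)).2 ?_)
        rwa [φ.right_inv hu.1]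
    · obtain ⟨u, rfl⟩ := dψ.mfderiv_surjective hfz u
      obtain ⟨v, rfl⟩ := hs u
      exact ⟨_, hB' v⟩
  -- The target chart is now the preferred one instead of `ψ`, because `tangentConeOf` is computed
  -- there; its derivative at its own centre is the identity.
  obtain ⟨G', hG, hG'⟩ := hasFDerivAt_in_charts hf hφ
    (IsManifold.chart_mem_maximalAtlas (I := 𝓘(ℂ, EY)) (n := ω) (f x)) hxφ
    (mem_chart_source EY (f x))
  have hvW := (memTF v).1 hv
  have hid : mfderiv 𝓘(ℂ, EY) 𝓘(ℂ, EY) (chartAt EY (f x)) (f x) =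
      ContinuousLinearMap.id ℂ _ := by
    have := IsManifold.of_le (I := 𝓘(ℂ, EY)) (M := Y) (n := ω) (m := 1) le_top
    have h := mfderiv_extChartAt_self (I := 𝓘(ℂ, EY)) (x := f x)
    simp only [mfld_simps] at h
    exact h
  have key := hG.mem_tangentConeAt (w := mfderiv 𝓘(ℂ, EX) 𝓘(ℂ, EX) φ x v)
    (D := chartAt EY (f x) '' (discr EX EY f ∩ (chartAt EY (f x)).source)) ?_
  · rw [hG', hid, φ.left_inv hxφ] at key
    exact key
  · filter_upwards [(tendsto_add_smul_nhds (φ x) (mfderiv 𝓘(ℂ, EX) 𝓘(ℂ, EX) φ x v)).eventually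
      ((hnhds hxφ hyψ).and (hnhds hxφ (mem_chart_source EY (f x))))] with t ht
    refine mem_image_of_mem _ ⟨mem_image_of_mem f (hcrit _ ht.1.1 ht.1.2 ?_), ht.2.2⟩
    rw [add_sub_cancel_left]
    exact W.smul_mem t hvW

/-- The preimage of a submanifold under a submersion is a submanifold. -/
theorem IsSubmanifoldAt.preimage [IsManifold 𝓘(ℂ, EX) ω X] {f : X → Y}
    (hf : ContMDiff 𝓘(ℂ, EX) 𝓘(ℂ, EY) ω f) {C : Set Y} {x : X}
    (hs : Function.Surjective (mfderiv 𝓘(ℂ, EX) 𝓘(ℂ, EY) f x))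
    {TC : Submodule ℂ (TangentSpace 𝓘(ℂ, EY) (f x))} (hTC : IsSubmanifoldAt C (f x) TC) :
    IsSubmanifoldAt (f ⁻¹' C) x
      (TC.comap (mfderiv 𝓘(ℂ, EX) 𝓘(ℂ, EY) f x).toLinearMap) := by
  obtain ⟨hyC, ψ, hψ, hyψ, V, hV, rfl⟩ := hTC
  refine ⟨hyC, ?_⟩
  set φ := chartAt EX x with hφdef
  have hφ : φ ∈ IsManifold.maximalAtlas 𝓘(ℂ, EX) ω X := IsManifold.chart_mem_maximalAtlas x
  have hxφ : x ∈ φ.source := mem_chart_source EX x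
  have dφ := OpenPartialHomeomorph.mdifferentiable_of_mem_maximalAtlas hφ
  have dψ := OpenPartialHomeomorph.mdifferentiable_of_mem_maximalAtlas hψ
  have hGc := contDiffAt_in_charts hf hφ hψ hxφ hyψ
  obtain ⟨A, hG, hA⟩ := hasFDerivAt_in_charts hf hφ hψ hxφ hyψ
  set G : EX → EY := fun z => ψ (f (φ.symm z)) with hGdef
  have hAs : Function.Surjective A := by
    intro u
    obtain ⟨u, rfl⟩ := dψ.mfderiv_surjective hyψ u
    obtain ⟨v, rfl⟩ := hs u
    exact ⟨_, hA v⟩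
  obtain ⟨R₀, hR₀⟩ := A.toLinearMap.exists_rightInverse_of_surjective (LinearMap.range_eq_top.2 hAs)
  let R : EY →L[ℂ] EX := LinearMap.toContinuousLinearMap R₀
  have hR : ∀ u, A (R u) = u := fun u => DFunLike.congr_fun hR₀ u
  -- Chosen so that `A ∘ Θ = G`: in the coordinate `Θ` the map becomes its linear part `A`. The
  -- correction has zero derivative at `φ x`, so `Θ` is a local biholomorphism.
  let Θ : EX → EX := fun z => z + R (G z - A z)
  have hΘc : ContDiffAt ℂ ω Θ (φ x) :=
    contDiffAt_id.add (R.contDiff.contDiffAt.comp _ (hGc.sub A.contDiff.contDiffAt))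
  have hΘd : HasFDerivAt Θ (ContinuousLinearMap.id ℂ EX) (φ x) := by
    have h := (hasFDerivAt_id (𝕜 := ℂ) (φ x)).add
      (R.hasFDerivAt.comp (φ x) (hG.sub A.hasFDerivAt))
    rw [sub_self, ContinuousLinearMap.comp_zero, add_zero] at h
    exact h
  have hAΘ : ∀ z z', A (Θ z - Θ z') = G z - G z' := by
    intro z z'
    simp [Θ, map_add, map_sub, hR]
  have hU : {z | z ∈ φ.target ∧ f (φ.symm z) ∈ ψ.source} ∈ 𝓝 (φ x) := by
    refine Filter.inter_mem (φ.open_target.mem_nhds (φ.map_source hxφ)) ?_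
    have hc : ContinuousAt (fun u => f (φ.symm u)) (φ x) :=
      hf.continuous.continuousAt.comp (φ.continuousAt_symm (φ.map_source hxφ))
    refine hc.tendsto.eventually (ψ.open_source.mem_nhds ?_)
    rwa [φ.left_inv hxφ]
  obtain ⟨e, heΘ, hpe, heU, he, he'⟩ := hΘc.exists_openPartialHomeomorph hΘd hU
  have hGφ : ∀ z ∈ φ.source, G (φ z) = ψ (f z) := fun z hz => by
    simp only [hGdef, φ.left_inv hz]
  refine ⟨φ.trans e, ?_, ⟨hxφ, hpe⟩, V.comap A.toLinearMap, ?_, ?_⟩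
  · refine OpenPartialHomeomorph.mem_maximalAtlas_of_contMDiffOn _ ?_ ?_
    · rw [OpenPartialHomeomorph.trans_source]
      exact he.contMDiffOn.comp
        ((contMDiffOn_of_mem_maximalAtlas hφ).mono inter_subset_left) fun z hz => hz.2
    · rw [OpenPartialHomeomorph.trans_target]
      exact (contMDiffOn_symm_of_mem_maximalAtlas hφ).comp
        (he'.contMDiffOn.mono inter_subset_left) fun z hz => hz.2
  · intro z hz
    have hz1 : z ∈ φ.source := hz.1
    have hfz : f z ∈ ψ.source := by
      have := (heU hz.2).2
      change f (φ.symm (φ z)) ∈ ψ.source at this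
      rwa [φ.left_inv hz1] at this
    rw [Submodule.mem_comap, OpenPartialHomeomorph.coe_trans, Function.comp_apply,
      Function.comp_apply, heΘ, ContinuousLinearMap.coe_coe, hAΘ, hGφ z hz1, hGφ x hxφ]
    exact hV _ hfz
  · have hd : HasFDerivAt e (ContinuousLinearMap.id ℂ EX) (φ x) := by rwa [heΘ]
    have hd' := (hd.hasMFDerivAt.comp x (dφ.mdifferentiableAt hxφ).hasMFDerivAt).mfderiv
    ext v
    rw [OpenPartialHomeomorph.coe_trans, hd']
    change mfderiv 𝓘(ℂ, EY) 𝓘(ℂ, EY) ψ (f x) (mfderiv 𝓘(ℂ, EX) 𝓘(ℂ, EY) f x v) ∈ V ↔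
      A (mfderiv 𝓘(ℂ, EX) 𝓘(ℂ, EX) φ x v) ∈ V
    rw [hA]
    exact Iff.rfl

end Manifold

theorem mainTheorem4 {EX EY X Y : Type*}
    [NormedAddCommGroup EX] [NormedSpace ℂ EX] [FiniteDimensional ℂ EX]
    [NormedAddCommGroup EY] [NormedSpace ℂ EY] [FiniteDimensional ℂ EY]
    [TopologicalSpace X] [T2Space X] [SecondCountableTopology X]
    [ChartedSpace EX X] [IsManifold 𝓘(ℂ, EX) ω X]
    [TopologicalSpace Y] [T2Space Y] [SecondCountableTopology Y]
    [ChartedSpace EY Y] [IsManifold 𝓘(ℂ, EY) ω Y]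
    (f : X → Y) (hf : IsAbelianFibration (EX := EX) (EY := EY) f)
    (C : Set Y) (hC : IsSmoothCurve (E := EY) C)
    (hC1 : C ⊆ (discrStratum EX EY f 1)ᶜ)
    (htrans : MeetsTransversally (E := EY) C (discr EX EY f)) :
    IsNeronRegular EX EY f C := by
  refine Subset.antisymm (fun x hx => ⟨mem_smoothLocus_iff.2
    (surjective_mfderiv_of_mem_smoothLocusOver hf.holomorphic htrans hx), ?_⟩) ?_
  · obtain ⟨_, _, h, -⟩ := hx
    exact h.1
  · rintro x ⟨hx, hxC⟩
    have hs := mem_smoothLocus_iff.1 hx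
    obtain ⟨T, hT, -⟩ := hC (f x) hxC
    exact ⟨T, _, hT, hT.preimage hf.holomorphic hs, rfl, Submodule.map_comap_eq_of_surjective hs T⟩
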